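/- A cubic ring is a commutative ring with unit that is free of rank $3$ as a $\mathbb{Z}$-module; it is called maximal if it is not isomorphic to a proper subring of a cubic ring. Write $\mathrm{Tr}$ for the trace of multiplication on a cubic ring. If $R$ is a cubic ring with nonzero discriminant, the restriction of $\mathrm{Tr}(z^2)$ to the trace-zero part of $\mathbb{Z}+3R$ can be written, in a $\mathbb{Z}$-basis, as $n\,Q(x,y)$, where $n$ is a positive integer and $Q(x,y)=rx^2+sxy+ty^2$ is a primitive integral binary quadratic form (that is, $\gcd(r,s,t)=1$), whose discriminant is $s^2-4rt$. The form $Q$, determined up to $\mathrm{GL}_2(\mathbb{Z})$-equivalence, is called the shape of $R$. A fundamental discriminant is an integer $D$ such that either $D\equiv 1 \pmod 4$ and $D$ is squarefree, or $D=4m$ with $m\equiv 2,3 \pmod 4$ and $m$ squarefree; in particular $1$ is a fundamental discriminant. If $R$ is a maximal cubic ring with nonzero discriminant whose shape is a form $Q$ of discriminant $D$, then $D$ is a fundamental discriminant, or $-D/3$ is an integer and a fundamental discriminant (or both). -/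

import Mathlib

/-- A cubic ring: a commutative ring with unit that is free of rank `3` as a `ℤ`-module. -/
structure IsCubicRing (R : Type*) [CommRing R] : Prop where
  free : Module.Free ℤ R
  finrank_eq : Module.finrank ℤ R = 3

universe u

/-- A cubic ring is maximal if it is not isomorphic to a proper subring of a cubic ring. -/
structure IsMaximalCubicRing (R : Type u) [CommRing R] : Prop where
  cubic : IsCubicRing R
  maximal : ∀ (S : Type u) [CommRing S], IsCubicRing S →
    ∀ φ : R →+* S, Function.Injective φ → Function.Surjective φ

/-- The integral binary quadratic form `r x² + s x y + t y²`. -/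
structure BinaryQuadForm where
  r : ℤ
  s : ℤ
  t : ℤ

namespace BinaryQuadForm

/-- The value `Q(x, y)`. -/
def eval (Q : BinaryQuadForm) (x y : ℤ) : ℤ :=
  Q.r * x ^ 2 + Q.s * x * y + Q.t * y ^ 2

/-- The discriminant `s² - 4 r t`. -/
def disc (Q : BinaryQuadForm) : ℤ :=
  Q.s ^ 2 - 4 * Q.r * Q.t

/-- The coefficients have no common prime factor (in particular they do not all vanish). -/
def IsPrimitive (Q : BinaryQuadForm) : Prop :=
  Int.gcd (Int.gcd Q.r Q.s) Q.t = 1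

end BinaryQuadForm

/-- The trace-zero part of the subring `ℤ + 3R` of `R`. -/
noncomputable def traceZeroLattice (R : Type*) [CommRing R] : Submodule ℤ R :=
  (Submodule.span ℤ {(1 : R)} ⊔ LinearMap.range ((3 : ℤ) • (LinearMap.id : R →ₗ[ℤ] R))) ⊓
    LinearMap.ker (Algebra.trace ℤ R)

/-- The cubic ring `R` has nonzero discriminant and shape (the class of) `Q`: the form `Q` is
primitive, and in a suitable `ℤ`-basis `α, β` of the trace-zero part of `ℤ + 3R` the trace form
`Tr (z²)` is `n Q(x, y)` for a positive integer `n`. As the basis is arbitrary, `Q` may be any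
representative of its `GL₂(ℤ)`-equivalence class. -/
structure HasShape (R : Type*) [CommRing R] (Q : BinaryQuadForm) : Prop where
  discr_ne_zero : ∃ b : Module.Basis (Fin 3) ℤ R, Algebra.discr ℤ b ≠ 0
  primitive : Q.IsPrimitive
  trace_form : ∃ (n : ℤ) (b : Module.Basis (Fin 2) ℤ (traceZeroLattice R)), 0 < n ∧
    ∀ x y : ℤ, Algebra.trace ℤ R ((x • (b 0 : R) + y • (b 1 : R)) ^ 2) = n * Q.eval x y

/-- Fundamental discriminants; the value `1` is included. -/
def IsFundamentalDiscriminant (D : ℤ) : Prop :=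
  (D % 4 = 1 ∧ Squarefree D) ∨
    ∃ m : ℤ, D = 4 * m ∧ (m % 4 = 2 ∨ m % 4 = 3) ∧ Squarefree m

/-! A basis `1, ω, θ` with `ωθ ∈ ℤ` identifies a cubic ring with the Delone–Faddeev ring of a binary
cubic form `f`. The trace form on the trace-zero part of `ℤ + 3R` is then six times the Hessian of
`f`, so the Hessian is `k Q` (`HasShape.exists_hessian`), and `D = disc Q` can be studied prime by
prime. For a maximal ring, no representative of `f` is divisible by `p` or satisfies `p ∣ c` and `p²
∣ d`.

If `p ∤ k` and `D` is too divisible by `p`, completing the square makes `s` and `t` highly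
divisible, and the relations between `f` and its Hessian force `p ∣ c`, `p² ∣ d`
(`not_double_root`). If `p ∣ k`, then `f` is a multiple of a cube modulo `p`; normalised to `f ≡ a
x³`, with `p ∤ a` and `p² ∤ d`, its Hessian shows `p ∤ D` for `p ≠ 3`
(`not_dvd_disc_of_dvd_content`).

Hence `p² ∤ D` for `p ≥ 5`, and `D = 4m` only with `m ≡ 2, 3` modulo 4. At 3 the argument gives only
`27 ∤ D`; when `9 ∣ D`, the fundamental discriminant is `-D/3`. -/

/-! ### Delone–Faddeev rings and the maps between them. -/

/-- The cubic ring attached by Delone and Faddeev to the binary cubic form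
`a x³ + b x² y + c x y² + d y³`. The triple `(x, y, z)` stands for `x + y ω + z θ`, where
`ω² = -ac + b ω - a θ`, `ω θ = -ad` and `θ² = -bd + d ω - c θ`. -/
@[ext]
structure DeloneFaddeev (a b c d : ℤ) where
  x : ℤ
  y : ℤ
  z : ℤ

namespace DeloneFaddeev

variable {a b c d : ℤ}

instance : Zero (DeloneFaddeev a b c d) := ⟨⟨0, 0, 0⟩⟩
instance : One (DeloneFaddeev a b c d) := ⟨⟨1, 0, 0⟩⟩
instance : Add (DeloneFaddeev a b c d) := ⟨fun u v => ⟨u.x + v.x, u.y + v.y, u.z + v.z⟩⟩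
instance : Neg (DeloneFaddeev a b c d) := ⟨fun u => ⟨-u.x, -u.y, -u.z⟩⟩
instance : Mul (DeloneFaddeev a b c d) := ⟨fun u v =>
  ⟨u.x * v.x - a * c * (u.y * v.y) - a * d * (u.y * v.z + u.z * v.y) - b * d * (u.z * v.z),
    u.x * v.y + u.y * v.x + b * (u.y * v.y) + d * (u.z * v.z),
    u.x * v.z + u.z * v.x - a * (u.y * v.y) - c * (u.z * v.z)⟩⟩

@[simp] theorem zero_x : (0 : DeloneFaddeev a b c d).x = 0 := rfl
@[simp] theorem zero_y : (0 : DeloneFaddeev a b c d).y = 0 := rfl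
@[simp] theorem zero_z : (0 : DeloneFaddeev a b c d).z = 0 := rfl
@[simp] theorem one_x : (1 : DeloneFaddeev a b c d).x = 1 := rfl
@[simp] theorem one_y : (1 : DeloneFaddeev a b c d).y = 0 := rfl
@[simp] theorem one_z : (1 : DeloneFaddeev a b c d).z = 0 := rfl

section

variable (u v : DeloneFaddeev a b c d)

@[simp] theorem add_x : (u + v).x = u.x + v.x := rfl
@[simp] theorem add_y : (u + v).y = u.y + v.y := rfl
@[simp] theorem add_z : (u + v).z = u.z + v.z := rfl
@[simp] theorem neg_x : (-u).x = -u.x := rfl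
@[simp] theorem neg_y : (-u).y = -u.y := rfl
@[simp] theorem neg_z : (-u).z = -u.z := rfl
@[simp] theorem mul_x : (u * v).x = u.x * v.x - a * c * (u.y * v.y)
    - a * d * (u.y * v.z + u.z * v.y) - b * d * (u.z * v.z) := rfl
@[simp] theorem mul_y : (u * v).y = u.x * v.y + u.y * v.x + b * (u.y * v.y)
    + d * (u.z * v.z) := rfl
@[simp] theorem mul_z : (u * v).z = u.x * v.z + u.z * v.x - a * (u.y * v.y)
    - c * (u.z * v.z) := rfl

end

instance : CommRing (DeloneFaddeev a b c d) where
  add_assoc u v w := by ext <;> simp [add_assoc]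
  zero_add u := by ext <;> simp
  add_zero u := by ext <;> simp
  add_comm u v := by ext <;> simp [add_comm]
  neg_add_cancel u := by ext <;> simp
  mul_assoc u v w := by ext <;> simp <;> ring
  one_mul u := by ext <;> simp
  mul_one u := by ext <;> simp
  mul_comm u v := by ext <;> simp <;> ring
  left_distrib u v w := by ext <;> simp <;> ring
  right_distrib u v w := by ext <;> simp <;> ring
  zero_mul u := by ext <;> simp
  mul_zero u := by ext <;> simp
  nsmul := nsmulRec
  zsmul := zsmulRec

/-- The additive identification with `ℤ³`. -/
def addEquivFun : DeloneFaddeev a b c d ≃+ (Fin 3 → ℤ) where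
  toFun u := ![u.x, u.y, u.z]
  invFun v := ⟨v 0, v 1, v 2⟩
  left_inv u := rfl
  right_inv v := by ext i; fin_cases i <;> rfl
  map_add' u v := by ext i; fin_cases i <;> rfl

theorem zsmul_x (n : ℤ) (u : DeloneFaddeev a b c d) : (n • u).x = n * u.x :=
  congrFun (map_zsmul addEquivFun n u) 0

theorem zsmul_y (n : ℤ) (u : DeloneFaddeev a b c d) : (n • u).y = n * u.y :=
  congrFun (map_zsmul addEquivFun n u) 1

theorem zsmul_z (n : ℤ) (u : DeloneFaddeev a b c d) : (n • u).z = n * u.z :=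
  congrFun (map_zsmul addEquivFun n u) 2

/-- The `ℤ`-basis `1, ω, θ`. -/
noncomputable def basis : Module.Basis (Fin 3) ℤ (DeloneFaddeev a b c d) :=
  Module.Basis.ofEquivFun addEquivFun.toIntLinearEquiv

theorem basis_repr (u : DeloneFaddeev a b c d) (i : Fin 3) :
    basis.repr u i = ![u.x, u.y, u.z] i := rfl

theorem basis_apply (i : Fin 3) :
    (basis i : DeloneFaddeev a b c d) = ![⟨1, 0, 0⟩, ⟨0, 1, 0⟩, ⟨0, 0, 1⟩] i := by
  apply basis.repr.injective
  ext j
  rw [Module.Basis.repr_self, basis_repr]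
  fin_cases i <;> fin_cases j <;> simp

/-- The lift is needed because maximality of `R : Type u` only tests overrings in `Type u`. -/
theorem isCubicRing_ulift : IsCubicRing (ULift.{u} (DeloneFaddeev a b c d)) := by
  let B := (basis (a := a) (b := b) (c := c) (d := d)).map
    (AddEquiv.ulift.{0, u} (α := DeloneFaddeev a b c d)).symm.toIntLinearEquiv
  exact ⟨Module.Free.of_basis B, by simp [Module.finrank_eq_card_basis B]⟩

theorem trace_eq (u : DeloneFaddeev a b c d) :
    Algebra.trace ℤ (DeloneFaddeev a b c d) u = 3 * u.x + b * u.y - c * u.z := by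
  rw [Algebra.trace_eq_matrix_trace basis, Matrix.trace, Fin.sum_univ_three]
  simp only [Matrix.diag_apply, Algebra.leftMulMatrix_eq_repr_mul, basis_repr, basis_apply]
  simp
  ring

/-- The substitution `f(x, y) ↦ f(x + k y, y)`. -/
def translateEquiv (k : ℤ) :
    DeloneFaddeev a (b + 3 * a * k) (c + 2 * b * k + 3 * a * k ^ 2)
      (d + c * k + b * k ^ 2 + a * k ^ 3) ≃+* DeloneFaddeev a b c d where
  -- The new basis is `ω + ak`, `θ + kω - (bk + ak²)`; the integer shifts keep the product in `ℤ`.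
  toFun u := ⟨u.x + a * k * u.y - (b * k + a * k ^ 2) * u.z, u.y + k * u.z, u.z⟩
  invFun u := ⟨u.x - a * k * (u.y - k * u.z) + (b * k + a * k ^ 2) * u.z, u.y - k * u.z, u.z⟩
  left_inv u := by ext <;> simp; ring
  right_inv u := by ext <;> simp; ring
  map_add' u v := by ext <;> simp <;> ring
  map_mul' u v := by ext <;> simp <;> ring

/-- The substitution `f(x, y) ↦ f(y, x)`. -/
def swapEquiv : DeloneFaddeev d c b a ≃+* DeloneFaddeev a b c d where
  toFun u := ⟨u.x, -u.z, -u.y⟩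
  invFun u := ⟨u.x, -u.z, -u.y⟩
  left_inv u := by ext <;> simp
  right_inv u := by ext <;> simp
  map_add' u v := by ext <;> simp <;> ring
  map_mul' u v := by ext <;> simp <;> ring

/-- The ring of `p f` as the subring `ℤ + p S` of the ring `S` of `f`. -/
def contentHom (p : ℤ) :
    DeloneFaddeev (p * a) (p * b) (p * c) (p * d) →+* DeloneFaddeev a b c d where
  toFun u := ⟨u.x, p * u.y, p * u.z⟩
  map_zero' := by ext <;> simp
  map_one' := by ext <;> simp
  map_add' u v := by ext <;> simp <;> ring
  map_mul' u v := by ext <;> simp <;> ring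

/-- The overring generated by `θ / p` when `p ∣ c` and `p² ∣ d`. -/
def divThetaHom (p : ℤ) :
    DeloneFaddeev a b (p * c) (p ^ 2 * d) →+* DeloneFaddeev (p * a) b c d where
  toFun u := ⟨u.x, u.y, p * u.z⟩
  map_zero' := by ext <;> simp
  map_one' := by ext <;> simp
  map_add' u v := by ext <;> simp; ring
  map_mul' u v := by ext <;> simp <;> ring

end DeloneFaddeev

/-! ### Maximality and primitivity as divisibility conditions. -/

theorem IsMaximalCubicRing.surjective_of_injective {R : Type u} [CommRing R]
    (hR : IsMaximalCubicRing R) {a b c d a' b' c' d' : ℤ} (e : R ≃+* DeloneFaddeev a b c d)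
    (φ : DeloneFaddeev a b c d →+* DeloneFaddeev a' b' c' d') (hφ : Function.Injective φ) :
    Function.Surjective φ := by
  have h := hR.maximal (ULift.{u} (DeloneFaddeev a' b' c' d'))
    DeloneFaddeev.isCubicRing_ulift
    (((ULift.ringEquiv.symm : DeloneFaddeev a' b' c' d' ≃+* ULift.{u} _) : _ →+* _).comp
      (φ.comp (e : R →+* _)))
    (ULift.ringEquiv.symm.injective.comp (hφ.comp e.injective))
  intro v
  obtain ⟨r, hr⟩ := h (ULift.up v)
  exact ⟨e r, congrArg ULift.down hr⟩

/-- In a maximal cubic ring no prime divides all coefficients of the cubic form. -/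
theorem IsMaximalCubicRing.not_dvd_content {R : Type u} [CommRing R]
    (hR : IsMaximalCubicRing R) {a b c d : ℤ} (e : R ≃+* DeloneFaddeev a b c d) {p : ℤ}
    (hp : Prime p) : ¬ (p ∣ a ∧ p ∣ b ∧ p ∣ c ∧ p ∣ d) := by
  rintro ⟨⟨a, rfl⟩, ⟨b, rfl⟩, ⟨c, rfl⟩, ⟨d, rfl⟩⟩
  have hs := hR.surjective_of_injective e (DeloneFaddeev.contentHom p) (by
    intro u v h
    simpa [DeloneFaddeev.contentHom, DeloneFaddeev.ext_iff, hp.ne_zero] using h)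
  obtain ⟨u, hu⟩ := hs ⟨0, 0, 1⟩
  exact hp.not_dvd_one ⟨u.z, (congrArg DeloneFaddeev.z hu).symm⟩

/-- In a maximal cubic ring the cubic form does not satisfy `p ∣ c` and `p² ∣ d`. -/
theorem IsMaximalCubicRing.not_dvd_sq_dvd {R : Type u} [CommRing R]
    (hR : IsMaximalCubicRing R) {a b c d : ℤ} (e : R ≃+* DeloneFaddeev a b c d) {p : ℤ}
    (hp : Prime p) : ¬ (p ∣ c ∧ p ^ 2 ∣ d) := by
  rintro ⟨⟨c, rfl⟩, ⟨d, rfl⟩⟩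
  have hs := hR.surjective_of_injective e (DeloneFaddeev.divThetaHom p) (by
    intro u v h
    simpa [DeloneFaddeev.divThetaHom, DeloneFaddeev.ext_iff, hp.ne_zero] using h)
  obtain ⟨u, hu⟩ := hs ⟨0, 0, 1⟩
  exact hp.not_dvd_one ⟨u.z, (congrArg DeloneFaddeev.z hu).symm⟩

theorem BinaryQuadForm.IsPrimitive.not_dvd {Q : BinaryQuadForm} (hQ : Q.IsPrimitive) {p : ℤ}
    (hp : Prime p) : ¬ (p ∣ Q.r ∧ p ∣ Q.s ∧ p ∣ Q.t) := by
  rintro ⟨h1, h2, h3⟩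
  have h := Int.dvd_coe_gcd (Int.dvd_coe_gcd h1 h2) h3
  rw [hQ] at h
  exact hp.not_dvd_one (by simpa using h)

/-- By Bézout, `n` is an integral combination of `n r`, `n s`, `n t`. -/
theorem BinaryQuadForm.IsPrimitive.dvd_of_dvd_mul {Q : BinaryQuadForm} (hQ : Q.IsPrimitive)
    {m n : ℤ} (hr : m ∣ n * Q.r) (hs : m ∣ n * Q.s) (ht : m ∣ n * Q.t) : m ∣ n := by
  have h1 : m ∣ n * (Int.gcd Q.r Q.s : ℤ) := by
    rw [Int.gcd_eq_gcd_ab, mul_add, ← mul_assoc, ← mul_assoc]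
    exact dvd_add (hr.mul_right _) (hs.mul_right _)
  have h2 : m ∣ n * (Int.gcd (Int.gcd Q.r Q.s) Q.t : ℤ) := by
    rw [Int.gcd_eq_gcd_ab, mul_add, ← mul_assoc, ← mul_assoc]
    exact dvd_add (h1.mul_right _) (ht.mul_right _)
  rw [hQ] at h2
  simpa using h2

/-! ### From the trace form to the Hessian. -/

section CubicRing

variable {R : Type*} [CommRing R]

theorem IsCubicRing.trace_intCast (hR : IsCubicRing R) (m : ℤ) :
    Algebra.trace ℤ R (m : R) = 3 * m := by
  have := hR.free
  have h := Algebra.trace_algebraMap (S := R) m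
  rw [hR.finrank_eq] at h
  simpa using h

/-- The norm of 3 is 27, which is not a unit. -/
theorem IsCubicRing.three_mul_ne_one (hR : IsCubicRing R) (v : R) : 3 * v ≠ 1 := by
  intro h
  have := hR.free
  have : Module.Finite ℤ R := Module.finite_of_finrank_pos (by rw [hR.finrank_eq]; norm_num)
  have B := Module.finBasisOfFinrankEq ℤ R hR.finrank_eq
  have h2 := congrArg (Algebra.norm ℤ) h
  have h3 : Algebra.norm ℤ (3 : R) = 27 := by
    have := Algebra.norm_algebraMap_of_basis B (3 : ℤ)
    simpa using this
  rw [map_mul, map_one, h3] at h2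
  omega

theorem IsCubicRing.three_dvd_of_three_mul_eq (hR : IsCubicRing R) {v : R} {m : ℤ}
    (h : 3 * v = m) : (3 : ℤ) ∣ m := by
  by_contra hm
  have : m % 3 = 1 ∨ m % 3 = 2 := by omega
  rcases this with h1 | h1
  · obtain ⟨k, rfl⟩ : ∃ k, m = 3 * k + 1 := ⟨m / 3, by omega⟩
    apply hR.three_mul_ne_one (v - k)
    rw [mul_sub, h]; push_cast; ring
  · obtain ⟨k, rfl⟩ : ∃ k, m = 3 * k - 1 := ⟨m / 3 + 1, by omega⟩
    apply hR.three_mul_ne_one (k - v)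
    rw [mul_sub, h]; push_cast; ring

theorem IsCubicRing.eq_of_three_mul_eq (hR : IsCubicRing R) {v w : R}
    (h : 3 * v = 3 * w) : v = w := by
  have := hR.free
  have h3 : (3 : ℤ) • v = (3 : ℤ) • w := by simpa [zsmul_eq_mul] using h
  exact smul_right_injective R (by norm_num : (3 : ℤ) ≠ 0) h3

theorem mem_traceZeroLattice {v : R} : v ∈ traceZeroLattice R ↔
    (∃ (m : ℤ) (w : R), v = m + 3 * w) ∧ Algebra.trace ℤ R v = 0 := by
  rw [traceZeroLattice, Submodule.mem_inf, Submodule.mem_sup, LinearMap.mem_ker]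
  refine and_congr_left fun _ => ⟨?_, ?_⟩
  · rintro ⟨y, hy, z, ⟨w, rfl⟩, rfl⟩
    obtain ⟨m, rfl⟩ := Submodule.mem_span_singleton.1 hy
    exact ⟨m, w, by simp⟩
  · rintro ⟨m, w, rfl⟩
    exact ⟨m, Submodule.mem_span_singleton.2 ⟨m, by simp⟩, 3 * w, ⟨w, by simp⟩, rfl⟩

theorem DeloneFaddeev.trace_ringEquiv {a b c d : ℤ} (e : DeloneFaddeev a b c d ≃+* R)
    (u : DeloneFaddeev a b c d) :
    Algebra.trace ℤ R (e u) = 3 * u.x + b * u.y - c * u.z := by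
  rw [← DeloneFaddeev.trace_eq]
  exact Algebra.trace_eq_of_algEquiv (AlgEquiv.ofRingEquiv (f := e) (fun r => by simp)) u

/-- The multiplication table of a cubic ring in a basis `1, ω, θ` with `ω θ ∈ ℤ`. -/
theorem exists_deloneFaddeev_of_mul_mem {ω θ : R} {N : ℤ}
    (hspan : ∀ v : R, ∃ x y z : ℤ, v = x + y * ω + z * θ)
    (hind : ∀ x y z : ℤ, (x + y * ω + z * θ : R) = 0 → x = 0 ∧ y = 0 ∧ z = 0)
    (hN : ω * θ = N) :
    ∃ (a b c d : ℤ) (e : DeloneFaddeev a b c d ≃+* R),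
      ∀ u, e u = u.x + u.y * ω + u.z * θ := by
  obtain ⟨i, b, a', hω⟩ := hspan (ω ^ 2)
  obtain ⟨j, d, c', hθ⟩ := hspan (θ ^ 2)
  obtain ⟨a, rfl⟩ : ∃ a, a' = -a := ⟨-a', by ring⟩
  obtain ⟨c, rfl⟩ : ∃ c, c' = -c := ⟨-c', by ring⟩
  push_cast at hω hθ
  -- Associativity, as `(ω²)θ = ω(ωθ)` and then `ω(θ²) = (ωθ)θ`, determines all three constant
  -- terms.
  obtain ⟨-, h1, h2⟩ := hind (b * N - a * j) (-(a * d) - N) (i + a * c) (by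
    push_cast
    linear_combination -θ * hω + a * hθ + (ω - b) * hN)
  obtain ⟨-, h3, -⟩ := hind (d * i - c * N) (j + d * b) (-(d * a) - N) (by
    push_cast
    linear_combination -ω * hθ - d * hω + (θ + c) * hN)
  obtain rfl : i = -(a * c) := by linarith
  obtain rfl : N = -(a * d) := by linarith
  obtain rfl : j = -(b * d) := by linarith
  push_cast at hω hθ hN
  let φ : DeloneFaddeev a b c d →+* R :=
    { toFun := fun u => u.x + u.y * ω + u.z * θ
      map_zero' := by simp
      map_one' := by simp
      map_add' := fun u v => by simp; ring
      map_mul' := fun u v => by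
        simp
        linear_combination -(u.y * v.y) * hω - (u.z * v.z) * hθ
          - (u.y * v.z + u.z * v.y) * hN }
  refine ⟨a, b, c, d, RingEquiv.ofBijective φ ⟨?_, ?_⟩, fun u => rfl⟩
  · rw [injective_iff_map_eq_zero]
    intro u hu
    obtain ⟨hx, hy, hz⟩ := hind _ _ _ hu
    exact DeloneFaddeev.ext hx hy hz
  · intro v
    obtain ⟨x, y, z, rfl⟩ := hspan v
    exact ⟨⟨x, y, z⟩, rfl⟩

/-- A basis of the trace-zero lattice is `3 ω - Tr ω, 3 θ - Tr θ` for a normalised basis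
`1, ω, θ` of the cubic ring. -/
theorem IsCubicRing.exists_deloneFaddeev (hR : IsCubicRing R)
    (B : Module.Basis (Fin 2) ℤ (traceZeroLattice R)) :
    ∃ (a b c d : ℤ) (e : DeloneFaddeev a b c d ≃+* R),
      e ⟨-b, 3, 0⟩ = B 0 ∧ e ⟨c, 0, 3⟩ = B 1 := by
  obtain ⟨⟨m₀, ω, hω⟩, tr₀⟩ := mem_traceZeroLattice.1 (B 0).2
  obtain ⟨⟨m₁, θ, hθ⟩, tr₁⟩ := mem_traceZeroLattice.1 (B 1).2
  have hspan : ∀ v : R, ∃ x y z : ℤ, v = x + y * ω + z * θ := by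
    intro v
    -- The element `3v - Tr v` lies in the lattice; its coordinates in `B` are those of `v` along
    -- `ω`, `θ`.
    have hv : ((-Algebra.trace ℤ R v : ℤ) : R) + 3 * v ∈ traceZeroLattice R := by
      refine mem_traceZeroLattice.2 ⟨⟨_, _, rfl⟩, ?_⟩
      have : (3 : R) * v = (3 : ℤ) • v := by simp
      rw [map_add, hR.trace_intCast, this, map_smul, smul_eq_mul]
      ring
    have h := congrArg (Subtype.val) (B.sum_repr ⟨_, hv⟩)
    rw [Fin.sum_univ_two] at h
    set y := B.repr ⟨_, hv⟩ 0
    set z := B.repr ⟨_, hv⟩ 1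
    simp only [Submodule.coe_add, Submodule.coe_smul, zsmul_eq_mul, hω, hθ] at h
    have h3 : 3 * (v - y * ω - z * θ) = ((Algebra.trace ℤ R v + y * m₀ + z * m₁ : ℤ) : R) := by
      push_cast at h ⊢
      linear_combination -h
    obtain ⟨x, hx⟩ := hR.three_dvd_of_three_mul_eq h3
    rw [hx] at h3
    push_cast at h3
    have := hR.eq_of_three_mul_eq h3
    exact ⟨x, y, z, by linear_combination this⟩
  have hind : ∀ x y z : ℤ, (x + y * ω + z * θ : R) = 0 → x = 0 ∧ y = 0 ∧ z = 0 := by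
    intro x y z h
    -- Three times the relation is an integer plus a lattice element; the trace kills the latter, so
    -- the integer vanishes.
    have h3 : ((3 * x - y * m₀ - z * m₁ : ℤ) : R) + y • (B 0 : R) + z • (B 1 : R) = 0 := by
      rw [hω, hθ, zsmul_eq_mul, zsmul_eq_mul]
      push_cast
      linear_combination 3 * h
    have ht := congrArg (Algebra.trace ℤ R) h3
    rw [map_add, map_add, map_smul, map_smul, tr₀, tr₁, hR.trace_intCast, map_zero] at ht
    have h0 : 3 * x - y * m₀ - z * m₁ = 0 := by simpa using ht
    rw [h0] at h3
    have h4 : y • B 0 + z • B 1 = 0 := by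
      apply Subtype.ext
      simpa using h3
    have := Fintype.linearIndependent_iff.1 B.linearIndependent ![y, z]
      (by simpa [Fin.sum_univ_two] using h4)
    obtain rfl : y = 0 := this 0
    obtain rfl : z = 0 := this 1
    simp only [zero_mul, sub_zero] at h0
    exact ⟨by omega, rfl, rfl⟩
  -- Shifting to `ω - n` and `θ - m` removes the linear terms of the product.
  obtain ⟨l, m, n, hmul⟩ := hspan (ω * θ)
  obtain ⟨a, b, c, d, e, he⟩ := exists_deloneFaddeev_of_mul_mem
    (ω := ω - n) (θ := θ - m) (N := l + n * m)
    (fun v => by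
      obtain ⟨x, y, z, rfl⟩ := hspan v
      exact ⟨x + y * n + z * m, y, z, by push_cast; ring⟩)
    (fun x y z h => by
      obtain ⟨h1, rfl, rfl⟩ := hind (x - y * n - z * m) y z (by
        push_cast
        linear_combination h)
      exact ⟨by simpa using h1, rfl, rfl⟩)
    (by push_cast; linear_combination hmul)
  have h0 : e ⟨m₀ + 3 * n, 3, 0⟩ = B 0 := by rw [he, hω]; push_cast; ring
  have h1 : e ⟨m₁ + 3 * m, 0, 3⟩ = B 1 := by rw [he, hθ]; push_cast; ring
  have e0 := DeloneFaddeev.trace_ringEquiv e ⟨m₀ + 3 * n, 3, 0⟩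
  have e1 := DeloneFaddeev.trace_ringEquiv e ⟨m₁ + 3 * m, 0, 3⟩
  rw [h0, tr₀] at e0
  rw [h1, tr₁] at e1
  simp only at e0 e1
  refine ⟨a, b, c, d, e, ?_, ?_⟩
  · rw [← h0]; congr 2; linarith
  · rw [← h1]; congr 2; linarith

/-- The shape of a cubic ring is the primitive part of the Hessian of its cubic form. -/
theorem HasShape.exists_hessian {Q : BinaryQuadForm} (hR : IsCubicRing R) (hQ : HasShape R Q) :
    ∃ (a b c d k : ℤ), Nonempty (R ≃+* DeloneFaddeev a b c d) ∧ b ^ 2 - 3 * a * c = k * Q.r ∧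
      b * c - 9 * a * d = k * Q.s ∧ c ^ 2 - 3 * b * d = k * Q.t := by
  obtain ⟨n, B, -, hB⟩ := hQ.trace_form
  obtain ⟨a, b, c, d, e, h0, h1⟩ := hR.exists_deloneFaddeev B
  have key : ∀ x y : ℤ, n * Q.eval x y = 6 * ((b ^ 2 - 3 * a * c) * x ^ 2
      + (b * c - 9 * a * d) * x * y + (c ^ 2 - 3 * b * d) * y ^ 2) := by
    intro x y
    have : x • (B 0 : R) + y • (B 1 : R) = e ⟨-b * x + c * y, 3 * x, 3 * y⟩ := by
      rw [← h0, ← h1, ← map_zsmul, ← map_zsmul, ← map_add]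
      congr 1
      ext <;> simp only [DeloneFaddeev.add_x, DeloneFaddeev.add_y, DeloneFaddeev.add_z,
        DeloneFaddeev.zsmul_x, DeloneFaddeev.zsmul_y, DeloneFaddeev.zsmul_z] <;> ring
    rw [← hB, this, ← map_pow, DeloneFaddeev.trace_ringEquiv, pow_two]
    simp
    ring
  have k1 := key 1 0
  have k2 := key 0 1
  have k3 := key 1 1
  simp only [BinaryQuadForm.eval] at k1 k2 k3
  -- The factor 6 divides `n` because `Q` is primitive, so the Hessian is an integral multiple of
  -- `Q`.
  obtain ⟨k, rfl⟩ : (6 : ℤ) ∣ n := hQ.primitive.dvd_of_dvd_mul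
    ⟨b ^ 2 - 3 * a * c, by linarith⟩ ⟨b * c - 9 * a * d, by linarith⟩
    ⟨c ^ 2 - 3 * b * d, by linarith⟩
  exact ⟨a, b, c, d, k, ⟨e.symm⟩, by linarith, by linarith, by linarith⟩

end CubicRing

/-! ### Local analysis of the Hessian. -/

/-- The cubic ring `R` belongs to the cubic form with coefficients `a, b, c, d`, whose Hessian is
`k` times the primitive form `r x² + s x y + t y²` of discriminant `D`. -/
structure HasHessian (R : Type*) [CommRing R] (a b c d k r s t D : ℤ) : Prop where
  equiv : Nonempty (R ≃+* DeloneFaddeev a b c d)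
  hr : b ^ 2 - 3 * a * c = k * r
  hs : b * c - 9 * a * d = k * s
  ht : c ^ 2 - 3 * b * d = k * t
  disc : s ^ 2 - 4 * r * t = D
  primitive : ∀ p : ℤ, Prime p → ¬ (p ∣ r ∧ p ∣ s ∧ p ∣ t)

namespace HasHessian

variable {R : Type u} [CommRing R] {a b c d k r s t D p : ℤ}

theorem translate (h : HasHessian R a b c d k r s t D) (j : ℤ) :
    HasHessian R a (b + 3 * a * j) (c + 2 * b * j + 3 * a * j ^ 2)
      (d + c * j + b * j ^ 2 + a * j ^ 3) k r (s + 2 * r * j) (t + s * j + r * j ^ 2) D where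
  equiv := h.equiv.map fun e => e.trans (DeloneFaddeev.translateEquiv j).symm
  hr := by linear_combination h.hr
  hs := by linear_combination h.hs + 2 * j * h.hr
  ht := by linear_combination h.ht + j * h.hs + j ^ 2 * h.hr
  disc := by linear_combination h.disc
  primitive p hp := by
    rintro ⟨h1, h2, h3⟩
    have hs : p ∣ s := (dvd_add_left ((h1.mul_left 2).mul_right j)).1 h2
    exact h.primitive p hp ⟨h1, hs, (dvd_add_left (hs.mul_right j)).1
      ((dvd_add_left (h1.mul_right _)).1 h3)⟩

theorem swap (h : HasHessian R a b c d k r s t D) : HasHessian R d c b a k t s r D where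
  equiv := h.equiv.map fun e => e.trans DeloneFaddeev.swapEquiv.symm
  hr := by linear_combination h.ht
  hs := by linear_combination h.hs
  ht := by linear_combination h.hr
  disc := by linear_combination h.disc
  primitive p hp := fun ⟨h1, h2, h3⟩ => h.primitive p hp ⟨h3, h2, h1⟩

theorem not_dvd_content (hR : IsMaximalCubicRing R) (h : HasHessian R a b c d k r s t D)
    (hp : Prime p) : ¬ (p ∣ a ∧ p ∣ b ∧ p ∣ c ∧ p ∣ d) :=
  h.equiv.elim fun e => hR.not_dvd_content e hp

theorem not_dvd_sq_dvd (hR : IsMaximalCubicRing R) (h : HasHessian R a b c d k r s t D)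
    (hp : Prime p) : ¬ (p ∣ c ∧ p ^ 2 ∣ d) :=
  h.equiv.elim fun e => hR.not_dvd_sq_dvd e hp

/-- A relation linear in `f` and in its Hessian: it turns divisibility of `s` and `t` into
divisibility of `c`. -/
theorem syzygy (h : HasHessian R a b c d k r s t D) : k * r * c = k * s * b - 3 * a * k * t := by
  linear_combination -c * h.hr + b * h.hs - 3 * a * h.ht

theorem exists_not_dvd_left (h : HasHessian R a b c d k r s t D) (hp : Prime p) (hs : p ∣ s) :
    ∃ a b c d r t, HasHessian R a b c d k r s t D ∧ ¬ p ∣ r := by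
  by_cases hr : p ∣ r
  · exact ⟨_, _, _, _, _, _, h.swap, fun ht => h.primitive p hp ⟨hr, hs, ht⟩⟩
  · exact ⟨_, _, _, _, _, _, h, hr⟩

/-- Completing the square modulo an odd prime power. -/
theorem exists_dvd (h : HasHessian R a b c d k r s t D) (hp : Prime p) (h2 : ¬ p ∣ 2) {m : ℕ}
    (hm : m ≠ 0) (hD : p ^ m ∣ D) :
    ∃ a b c d r s t, HasHessian R a b c d k r s t D ∧ ¬ p ∣ r ∧ p ^ m ∣ s ∧ p ^ m ∣ t := by
  obtain ⟨a, b, c, d, r, s, t, h, hr⟩ :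
      ∃ a b c d r s t, HasHessian R a b c d k r s t D ∧ ¬ p ∣ r := by
    by_cases hr : p ∣ r
    · have hs : p ∣ s := by
        have : p ∣ s ^ 2 := by
          rw [show s ^ 2 = D + 4 * t * r by linear_combination h.disc]
          exact dvd_add ((dvd_pow_self p hm).trans hD) (hr.mul_left _)
        exact hp.dvd_of_dvd_pow this
      obtain ⟨a, b, c, d, r, t, h⟩ := h.exists_not_dvd_left hp hs
      exact ⟨_, _, _, _, _, _, _, h⟩
    · exact ⟨_, _, _, _, _, _, _, h, hr⟩
  have h2r : ¬ p ∣ 2 * r := fun H => (hp.dvd_or_dvd H).elim h2 hr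
  obtain ⟨u, v, huv⟩ : IsCoprime (2 * r) (p ^ m) :=
    ((hp.coprime_iff_not_dvd.2 h2r).symm).pow_right
  -- Here `u` inverts `2r` modulo `p ^ m`, so the new `s` vanishes there; `4rt = s² - D` then
  -- handles `t`.
  have h' := h.translate (-(s * u))
  have hs' : p ^ m ∣ s + 2 * r * (-(s * u)) := ⟨s * v, by linear_combination -s * huv⟩
  refine ⟨_, _, _, _, _, _, _, h', hr, hs', ?_⟩
  have h4 : ¬ p ∣ 2 * (2 * r) := fun H => (hp.dvd_or_dvd H).elim h2 h2r
  apply hp.pow_dvd_of_dvd_mul_left m h4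
  rw [show ∀ x y : ℤ, 2 * (2 * r) * x = y * y - (y ^ 2 - 4 * r * x) by intros; ring, h'.disc]
  exact dvd_sub (hs'.mul_right _) hD

/-- The syzygy gives `p ∣ c`, so `kr = b² - 3ac` makes `b` a unit modulo `p`, and `3bd = c² - kt`
gives `p² ∣ d`. -/
theorem not_double_root (hR : IsMaximalCubicRing R) (h : HasHessian R a b c d k r s t D)
    (hp : Prime p) (h3 : ¬ p ∣ 3) (hk : ¬ p ∣ k) (hr : ¬ p ∣ r) (hs : p ∣ s)
    (ht : p ^ 2 ∣ t) : False := by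
  have hkr : ¬ p ∣ k * r := fun H => (hp.dvd_or_dvd H).elim hk hr
  have hc : p ∣ c := by
    apply (hp.dvd_or_dvd (a := k * r) _).resolve_left hkr
    rw [h.syzygy]
    exact dvd_sub ((hs.mul_left k).mul_right b)
      (((dvd_pow_self p two_ne_zero).trans ht).mul_left _)
  have hb : ¬ p ∣ b := by
    intro hb
    apply hkr
    rw [← h.hr, pow_two]
    exact dvd_sub (hb.mul_left _) (hc.mul_left _)
  refine h.not_dvd_sq_dvd hR hp ⟨hc, ?_⟩
  apply hp.pow_dvd_of_dvd_mul_left 2 (fun H => (hp.dvd_or_dvd H).elim h3 hb)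
  rw [show 3 * b * d = c ^ 2 - k * t by linear_combination -h.ht]
  exact dvd_sub (pow_dvd_pow_of_dvd hc 2) (ht.mul_left _)

/-- As for other primes, but the 3 in `3bd` costs one power, hence the cubes in the hypotheses. -/
theorem not_double_root_three (hR : IsMaximalCubicRing R) (h : HasHessian R a b c d k r s t D)
    (hk : ¬ 3 ∣ k) (hr : ¬ 3 ∣ r) (hs : 3 ^ 3 ∣ s) (ht : 3 ^ 3 ∣ t) : False := by
  have hp := Int.prime_three
  have hkr : ¬ 3 ∣ k * r := fun H => (hp.dvd_or_dvd H).elim hk hr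
  have hc : 3 ^ 3 ∣ c := by
    apply hp.pow_dvd_of_dvd_mul_left 3 hkr
    rw [h.syzygy]
    exact dvd_sub ((hs.mul_left k).mul_right b) (ht.mul_left _)
  have hc3 : 3 ∣ c := (dvd_pow_self 3 three_ne_zero).trans hc
  have hb : ¬ 3 ∣ b := by
    intro hb
    apply hkr
    rw [← h.hr, pow_two]
    exact dvd_sub (hb.mul_left _) (hc3.mul_left _)
  refine h.not_dvd_sq_dvd hR hp ⟨hc3, ?_⟩
  apply hp.pow_dvd_of_dvd_mul_left 2 hb
  have : (3 : ℤ) ^ 3 ∣ 3 * (b * d) := by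
    rw [show 3 * (b * d) = c * c - k * t by linear_combination -h.ht]
    exact dvd_sub (hc.mul_left _) (ht.mul_left _)
  omega

/-- If `k` were odd, one could arrange `r` odd and `s = 2q` with `q ≡ m` modulo 2; then `rt = q² -
m` is divisible by 4, giving a forbidden double root. -/
theorem two_not_dvd_content (hR : IsMaximalCubicRing R) (h : HasHessian R a b c d k r s t D)
    {m : ℤ} (hD : D = 4 * m) (hm : m % 4 = 0 ∨ m % 4 = 1) : 2 ∣ k := by
  by_contra hk
  have hs : 2 ∣ s := by
    have : 2 ∣ s ^ 2 := ⟨2 * m + 2 * r * t, by linear_combination h.disc + hD⟩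
    exact Int.prime_two.dvd_of_dvd_pow this
  obtain ⟨a, b, c, d, r, t, h, hr⟩ := h.exists_not_dvd_left Int.prime_two hs
  obtain ⟨a, b, c, d, s, t, h, hs, hsm⟩ : ∃ a b c d s t, HasHessian R a b c d k r s t D ∧
      2 ∣ s ∧ (s / 2) % 2 = m % 2 := by
    by_cases hsm : (s / 2) % 2 = m % 2
    · exact ⟨_, _, _, _, _, _, h, hs, hsm⟩
    -- Translation by 1 adds the odd number `r` to `s / 2`.
    · exact ⟨_, _, _, _, _, _, h.translate 1, by omega, by omega⟩
  obtain ⟨q, rfl⟩ := hs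
  refine h.not_double_root hR Int.prime_two (by decide) hk hr ⟨q, rfl⟩ ?_
  apply Int.prime_two.pow_dvd_of_dvd_mul_left 2 hr
  have e : r * t = q ^ 2 - m := by linarith [h.disc]
  rw [e]
  rcases hm with hm | hm
  · obtain ⟨n, rfl⟩ : ∃ n, m = 4 * n := ⟨m / 4, by omega⟩
    obtain ⟨l, rfl⟩ : ∃ l, q = 2 * l := ⟨q / 2, by omega⟩
    exact ⟨l ^ 2 - n, by ring⟩
  · obtain ⟨n, rfl⟩ : ∃ n, m = 4 * n + 1 := ⟨m / 4, by omega⟩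
    obtain ⟨l, rfl⟩ : ∃ l, q = 2 * l + 1 := ⟨q / 2, by omega⟩
    exact ⟨l ^ 2 + l - n, by ring⟩

theorem dvd_left_coeffs (h : HasHessian R a b c d k r s t D) (hp : Prime p) (hk : p ∣ k)
    (ha : p ∣ a) : p ∣ b ∧ p ∣ c := by
  have hb : p ∣ b := by
    apply hp.dvd_of_dvd_pow (n := 2)
    rw [show b ^ 2 = k * r + a * (3 * c) by linear_combination h.hr]
    exact dvd_add (hk.mul_right _) (ha.mul_right _)
  refine ⟨hb, hp.dvd_of_dvd_pow (n := 2) ?_⟩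
  rw [show c ^ 2 = k * t + b * (3 * d) by linear_combination h.ht]
  exact dvd_add (hk.mul_right _) (hb.mul_right _)

/-- The Hessian vanishes modulo `p`, so `f` is a multiple of a cube there: completing the cube,
possible as `3a` is invertible, kills `b`, and then `c` and `d`. -/
theorem exists_triple_root (h : HasHessian R a b c d k r s t D) (hp : Prime p)
    (h3 : ¬ p ∣ 3) (hk : p ∣ k) :
    ∃ a b c d r s t, HasHessian R a b c d k r s t D ∧ p ∣ b ∧ p ∣ c ∧ p ∣ d := by
  by_cases ha : p ∣ a
  · obtain ⟨hb, hc⟩ := h.dvd_left_coeffs hp hk ha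
    exact ⟨_, _, _, _, _, _, _, h.swap, hc, hb, ha⟩
  · have h3a : ¬ p ∣ 3 * a := fun H => (hp.dvd_or_dvd H).elim h3 ha
    obtain ⟨u, v, huv⟩ : IsCoprime (3 * a) p := (hp.coprime_iff_not_dvd.2 h3a).symm
    have h' := h.translate (-(b * u))
    have hb : p ∣ b + 3 * a * (-(b * u)) := ⟨b * v, by linear_combination -b * huv⟩
    refine ⟨_, _, _, _, _, _, _, h', hb, ?_⟩
    generalize b + 3 * a * (-(b * u)) = b' at h' hb
    generalize c + _ + _ = c' at h'
    generalize d + _ + _ + _ = d' at h'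
    have hc : p ∣ c' := by
      apply (hp.dvd_or_dvd (a := 3 * a) _).resolve_left h3a
      rw [show 3 * a * c' = b' * b' - k * r by linear_combination -h'.hr]
      exact dvd_sub (hb.mul_right _) (hk.mul_right _)
    refine ⟨hc, ?_⟩
    apply (hp.dvd_or_dvd (a := 3 * (3 * a)) _).resolve_left
      (fun H => (hp.dvd_or_dvd H).elim h3 h3a)
    rw [show 3 * (3 * a) * d' = b' * c' - k * (s + 2 * r * (-(b * u))) by
      linear_combination -h'.hs]
    exact dvd_sub (hb.mul_right _) (hk.mul_right _)

/-- Modulo 3 the Hessian coefficients reduce to `b²`, `bc`, `c²`, so `f ≡ a x³ + d y³`, a cube since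
cubing is additive. -/
theorem exists_triple_root_three (h : HasHessian R a b c d k r s t D) (hk : 3 ∣ k) :
    ∃ a b c d r s t, HasHessian R a b c d k r s t D ∧ 3 ∣ b ∧ 3 ∣ c ∧ 3 ∣ d := by
  have hp := Int.prime_three
  by_cases ha : 3 ∣ a
  · obtain ⟨hb, hc⟩ := h.dvd_left_coeffs hp hk ha
    exact ⟨_, _, _, _, _, _, _, h.swap, hc, hb, ha⟩
  · have hb : 3 ∣ b := by
      apply hp.dvd_of_dvd_pow (n := 2)
      rw [show b ^ 2 = k * r + 3 * (a * c) by linear_combination h.hr]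
      exact dvd_add (hk.mul_right _) (dvd_mul_right _ _)
    have hc : 3 ∣ c := by
      apply hp.dvd_of_dvd_pow (n := 2)
      rw [show c ^ 2 = k * t + 3 * (b * d) by linear_combination h.ht]
      exact dvd_add (hk.mul_right _) (dvd_mul_right _ _)
    obtain ⟨j, hj⟩ : ∃ j : ℤ, 3 ∣ d + a * j ^ 3 := by
      have ha : a % 3 = 1 ∨ a % 3 = 2 := by omega
      have hd : d % 3 = 0 ∨ d % 3 = 1 ∨ d % 3 = 2 := by omega
      rcases hd with hd | hd | hd
      · exact ⟨0, by omega⟩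
      · rcases ha with ha | ha
        · exact ⟨-1, by omega⟩
        · exact ⟨1, by omega⟩
      · rcases ha with ha | ha
        · exact ⟨1, by omega⟩
        · exact ⟨-1, by omega⟩
    refine ⟨_, _, _, _, _, _, _, h.translate j, ?_, ?_, ?_⟩
    · exact dvd_add hb ((dvd_mul_right 3 a).mul_right j)
    · exact dvd_add (dvd_add hc ((hb.mul_left 2).mul_right j))
        ((dvd_mul_right 3 a).mul_right _)
    · rw [show d + c * j + b * j ^ 2 + a * j ^ 3 = c * j + b * j ^ 2 + (d + a * j ^ 3) by ring]
      exact dvd_add (dvd_add (hc.mul_right _) (hb.mul_right _)) hj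

/-- With `f ≡ a x³` modulo `p`, maximality makes `a` and `d / p` units. After division of the
Hessian by `p`, the middle coefficient is a unit and the last is divisible by `p`, so `D ≡ s²` is a
unit. -/
theorem not_dvd_disc_of_dvd_content (hR : IsMaximalCubicRing R)
    (h : HasHessian R a b c d k r s t D) (hp : Prime p) (h3 : ¬ p ∣ 3) (hk : p ∣ k) :
    ¬ p ∣ D := by
  intro hD
  obtain ⟨a, b, c, d, r, s, t, h, hb, hc, hd⟩ := h.exists_triple_root hp h3 hk
  have ha : ¬ p ∣ a := fun ha => h.not_dvd_content hR hp ⟨ha, hb, hc, hd⟩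
  have hd2 : ¬ p ^ 2 ∣ d := fun H => h.not_dvd_sq_dvd hR hp ⟨hc, H⟩
  obtain ⟨b, rfl⟩ := hb
  obtain ⟨c, rfl⟩ := hc
  obtain ⟨d, rfl⟩ := hd
  obtain ⟨k, rfl⟩ := hk
  have hd : ¬ p ∣ d := fun H => hd2 (by rw [pow_two]; exact mul_dvd_mul_left p H)
  have hs : k * s = p * (b * c) - 3 * 3 * a * d :=
    mul_left_cancel₀ hp.ne_zero (by linear_combination -h.hs)
  have ht : k * t = p * (c ^ 2 - 3 * b * d) :=
    mul_left_cancel₀ hp.ne_zero (by linear_combination -h.ht)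
  have hks : ¬ p ∣ k * s := by
    rw [hs, dvd_sub_right (dvd_mul_right _ _)]
    simp only [hp.dvd_mul, h3, ha, hd, or_self, not_false_eq_true]
  have hpt : p ∣ t := (hp.dvd_or_dvd (Dvd.intro _ ht.symm)).resolve_left
    (fun H => hks (H.mul_right _))
  apply hks
  refine (hp.dvd_of_dvd_pow (n := 2) ?_).mul_left k
  rw [show s ^ 2 = D + 4 * r * t by linear_combination h.disc]
  exact dvd_add hD (hpt.mul_left _)

theorem not_dvd_disc_of_three_dvd_content (hR : IsMaximalCubicRing R)
    (h : HasHessian R a b c d k r s t D) (hk : 3 ∣ k) : ¬ 3 ^ 3 ∣ D := by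
  rintro ⟨D, rfl⟩
  have hp := Int.prime_three
  obtain ⟨a, b, c, d, r, s, t, h, hb, hc, hd⟩ := h.exists_triple_root_three hk
  have ha : ¬ 3 ∣ a := fun ha => h.not_dvd_content hR hp ⟨ha, hb, hc, hd⟩
  have hd2 : ¬ 3 ^ 2 ∣ d := fun H => h.not_dvd_sq_dvd hR hp ⟨hc, H⟩
  obtain ⟨b, rfl⟩ := hb
  obtain ⟨c, rfl⟩ := hc
  obtain ⟨d, rfl⟩ := hd
  obtain ⟨k, rfl⟩ := hk
  have hd : ¬ 3 ∣ d := by omega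
  have prim : ∀ {l : ℤ}, 3 ∣ l * r → 3 ∣ l * s → 3 ∣ l * t → 3 ∣ l := by
    intro l h1 h2 h3
    by_contra hl
    exact h.primitive 3 hp ⟨(hp.dvd_or_dvd h1).resolve_left hl,
      (hp.dvd_or_dvd h2).resolve_left hl, (hp.dvd_or_dvd h3).resolve_left hl⟩
  have hr := h.hr
  have hs := h.hs
  have ht := h.ht
  -- All Hessian coefficients are divisible by 9, and primitivity of `Q` moves this factor into `k`.
  obtain ⟨k, rfl⟩ : 3 ∣ k := prim ⟨b ^ 2 - a * c, by linarith⟩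
    ⟨b * c - 3 * a * d, by linarith⟩ ⟨c ^ 2 - 3 * b * d, by linarith⟩
  replace hr : b ^ 2 - a * c = k * r := by linarith
  replace hs : b * c - 3 * a * d = k * s := by linarith
  replace ht : c ^ 2 - 3 * b * d = k * t := by linarith
  have hD : (b * c - 3 * a * d) ^ 2 - 4 * (b ^ 2 - a * c) * (c ^ 2 - 3 * b * d)
      = 27 * (k ^ 2 * D) := by
    rw [hr, hs, ht]
    linear_combination k ^ 2 * h.disc
  by_cases hc : 3 ∣ c
  · obtain ⟨c, rfl⟩ := hc
    by_cases hb : 3 ∣ b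
    · obtain ⟨b, rfl⟩ := hb
      -- A further 3 divides the Hessian; once removed, the middle coefficient is `-ad` modulo 3, a
      -- unit, as for other primes.
      obtain ⟨k, rfl⟩ : 3 ∣ k := prim ⟨3 * b ^ 2 - a * c, by linarith⟩
        ⟨3 * (b * c) - a * d, by linarith⟩ ⟨3 * c ^ 2 - 3 * (b * d), by linarith⟩
      have hks : ¬ 3 ∣ k * s := by
        rw [show k * s = 3 * (b * c) - a * d by linarith, dvd_sub_right (dvd_mul_right _ _)]
        simp [hp.dvd_mul, ha, hd]
      have hpt : 3 ∣ t := by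
        apply (hp.dvd_or_dvd (a := k) ⟨c ^ 2 - b * d, by linarith⟩).resolve_left
        exact fun H => hks (H.mul_right _)
      obtain ⟨t, rfl⟩ := hpt
      apply hks
      refine (hp.dvd_of_dvd_pow (n := 2) ?_).mul_left k
      exact ⟨9 * D + 4 * r * t, by linear_combination h.disc⟩
    -- With `3 ∣ c`, the left side of `hD` is `12 b³ d` modulo 9.
    · have : 3 ∣ b * b * b * d := by
        refine ⟨3 * k ^ 2 * D - (b * c - a * d) ^ 2 + 4 * b ^ 2 * c ^ 2
          - 4 * a * c * (3 * c ^ 2 - b * d) - b ^ 3 * d, ?_⟩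
        linarith
      simp [hp.dvd_mul, hb, hd] at this
  -- Modulo 3, the left side of `hD` is `a c³`.
  · have : 3 ∣ a * c * c * c := by
      refine ⟨9 * k ^ 2 * D + 2 * a * b * c * d - 3 * a ^ 2 * d ^ 2 + b ^ 2 * c ^ 2
        - 4 * b ^ 3 * d + 4 * a * b * c * d - a * c ^ 3, ?_⟩
      linarith
    simp [hp.dvd_mul, ha, hc] at this

theorem not_sq_dvd_disc (hR : IsMaximalCubicRing R) (h : HasHessian R a b c d k r s t D)
    (hp : Prime p) (h2 : ¬ p ∣ 2) (h3 : ¬ p ∣ 3) : ¬ p ^ 2 ∣ D := by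
  intro hD
  by_cases hk : p ∣ k
  · exact h.not_dvd_disc_of_dvd_content hR hp h3 hk ((dvd_pow_self p two_ne_zero).trans hD)
  · obtain ⟨a, b, c, d, r, s, t, h, hr, hs, ht⟩ := h.exists_dvd hp h2 two_ne_zero hD
    exact h.not_double_root hR hp h3 hk hr ((dvd_pow_self p two_ne_zero).trans hs) ht

theorem not_twentySeven_dvd_disc (hR : IsMaximalCubicRing R)
    (h : HasHessian R a b c d k r s t D) : ¬ 3 ^ 3 ∣ D := by
  intro hD
  by_cases hk : 3 ∣ k
  · exact h.not_dvd_disc_of_three_dvd_content hR hk hD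
  · obtain ⟨a, b, c, d, r, s, t, h, hr, hs, ht⟩ :=
      h.exists_dvd Int.prime_three (by decide) three_ne_zero hD
    exact h.not_double_root_three hR hk hr hs ht

theorem disc_div_four (hR : IsMaximalCubicRing R) (h : HasHessian R a b c d k r s t D) {m : ℤ}
    (hD : D = 4 * m) : m % 4 = 2 ∨ m % 4 = 3 := by
  by_contra hm
  have hk := h.two_not_dvd_content hR hD (by omega)
  exact h.not_dvd_disc_of_dvd_content hR Int.prime_two (by decide) hk ⟨2 * m, by rw [hD]; ring⟩

theorem disc_emod_four (h : HasHessian R a b c d k r s t D) : D % 4 = 0 ∨ D % 4 = 1 := by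
  have hD : D = s * s - 4 * (r * t) := by linear_combination -h.disc
  rcases Int.even_or_odd' s with ⟨q, rfl | rfl⟩
  · left; rw [hD, show 2 * q * (2 * q) = 4 * (q * q) by ring]; omega
  · right
    rw [hD, show (2 * q + 1) * (2 * q + 1) = 4 * (q * q + q) + 1 by ring]; omega

end HasHessian

/-! ### Assembling the local conditions. -/

theorem Int.squarefree_of_forall_prime {n : ℤ} (h : ∀ p : ℕ, p.Prime → ¬ (p : ℤ) ^ 2 ∣ n) :
    Squarefree n := by
  rw [← Int.squarefree_natAbs, Nat.squarefree_iff_prime_squarefree]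
  intro p hp hd
  refine h p hp ?_
  rw [← Int.natCast_dvd, Nat.cast_mul] at hd
  rwa [pow_two]

/-- An integer passing the local tests is a fundamental discriminant. -/
theorem isFundamentalDiscriminant_of_local {D : ℤ} (h4 : D % 4 = 0 ∨ D % 4 = 1)
    (h2 : ∀ m, D = 4 * m → m % 4 = 2 ∨ m % 4 = 3)
    (hp : ∀ p : ℕ, p.Prime → p ≠ 2 → ¬ (p : ℤ) ^ 2 ∣ D) : IsFundamentalDiscriminant D := by
  rcases h4 with h4 | h4
  · obtain ⟨m, rfl⟩ : ∃ m, D = 4 * m := ⟨D / 4, by omega⟩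
    refine Or.inr ⟨m, rfl, h2 m rfl, Int.squarefree_of_forall_prime fun p pp hd => ?_⟩
    rcases eq_or_ne p 2 with rfl | hp2
    · have := h2 m rfl
      norm_num at hd
      omega
    · exact hp p pp hp2 (hd.mul_left 4)
  · refine Or.inl ⟨h4, Int.squarefree_of_forall_prime fun p pp hd => ?_⟩
    rcases eq_or_ne p 2 with rfl | hp2
    · norm_num at hd
      omega
    · exact hp p pp hp2 hd

theorem proposition4p8 (R : Type u) [CommRing R] (hR : IsMaximalCubicRing R)
    (Q : BinaryQuadForm) (hQ : HasShape R Q) :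
    IsFundamentalDiscriminant Q.disc ∨
      ∃ d : ℤ, Q.disc = -3 * d ∧ IsFundamentalDiscriminant d := by
  obtain ⟨a, b, c, d, k, he, hr, hs, ht⟩ := hQ.exists_hessian hR.cubic
  have h : HasHessian R a b c d k Q.r Q.s Q.t Q.disc :=
    ⟨he, hr, hs, ht, rfl, fun p hp => hQ.primitive.not_dvd hp⟩
  have h4 := h.disc_emod_four
  have h27 := h.not_twentySeven_dvd_disc hR
  have hsq : ∀ p : ℕ, p.Prime → p ≠ 2 → p ≠ 3 → ¬ (p : ℤ) ^ 2 ∣ Q.disc := by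
    intro p hp h2 h3
    refine h.not_sq_dvd_disc hR (Nat.prime_iff_prime_int.1 hp) ?_ ?_
    · exact fun H => h2 ((Nat.prime_dvd_prime_iff_eq hp Nat.prime_two).1 (by exact_mod_cast H))
    · exact fun H => h3 ((Nat.prime_dvd_prime_iff_eq hp Nat.prime_three).1 (by exact_mod_cast H))
  have hdiv : ∀ m, Q.disc = 4 * m → m % 4 = 2 ∨ m % 4 = 3 := fun m => h.disc_div_four hR
  generalize Q.disc = D at *
  -- If `9 ∣ D`, then `e = -D/3` has `9 ∤ e` because `27 ∤ D`, and the conditions at 2 carry over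
  -- since `-3 ≡ 1` modulo 4.
  by_cases h9 : 9 ∣ D
  · obtain ⟨e, rfl⟩ : ∃ e, D = -3 * e := ⟨-(D / 3), by omega⟩
    refine Or.inr ⟨e, rfl, isFundamentalDiscriminant_of_local (by omega) ?_ ?_⟩
    · rintro m rfl
      have := hdiv (-3 * m) (by ring)
      omega
    · intro p hp h2 hd
      rcases eq_or_ne p 3 with rfl | h3
      · norm_num at hd
        omega
      · exact hsq p hp h2 h3 (hd.mul_left _)
  · refine Or.inl (isFundamentalDiscriminant_of_local h4 hdiv fun p hp h2 hd => ?_)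
    rcases eq_or_ne p 3 with rfl | h3
    · norm_num at hd
      exact h9 hd
    · exact hsq p hp h2 h3 hd
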